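/- Let $G=(V,E)$ be a finite simple graph and $\bot\notin V$. A \emph{transformation} on $G$ is a map $\varphi:V\cup\{\bot\}\to V\cup\{\bot\}$ with $\varphi(\bot)=\bot$ that is injective on $V_{\not\bot}=\{v\in V:\varphi(v)\neq\bot\}$; its \emph{loss} is $|\{v\in V:\varphi(v)=\bot\}|$. A \emph{translation} on $G$ is a transformation $\psi$ such that $\{v,\psi(v)\}\in E$ for all $v\in V_{\not\bot}$, and such that, for all $v_1,v_2\in V_{\not\bot}$, $\{v_1,v_2\}\in E$ if and only if $\{\psi(v_1),\psi(v_2)\}\in E$. For translations write $\psi_1\prec\psi_2$ if $\mathrm{loss}(\psi_1)>\mathrm{loss}(\psi_2)$ and the two have an edge in common, i.e. there is $v\in V$ with $\psi_1(v)=\psi_2(v)\neq\bot$. A translation $\psi_1$ is \emph{minimal} if there is no translation $\psi_2$ with $\psi_1\prec\psi_2$. Pseudo-minimality is defined by recursion on the loss: a translation $\psi_1$ is \emph{pseudo-minimal} if and only if it is minimal or no translation $\psi_2$ with $\psi_1\prec\psi_2$ is pseudo-minimal. Let $d=(d_1,\dots,d_D)$ be a vector of positive integers satisfying the growth assumption $$d_D\ge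 3\quad\text{and}\quad d_i\ge 2+2\prod_{j=i+1}^{D}d_j\ \text{ for all } 1\le i\le D-1,$$ and let $G_g$ be the grid graph with vertex set $V_g=\prod_{i=1}^{D}\{1,\dots,d_i\}$, two vertices being adjacent if and only if they differ by exactly $1$ in one coordinate and agree in all the others. For $i\in\{1,\dots,D\}$ let $e_i$ be the Dirac vector, with $i$-th entry $1$ and all other entries $0$, and let $\psi_i$ be the Euclidean translation by $e_i$: $\psi_i(\bot)=\bot$ and, for $v\in V_g$, $\psi_i(v)=v+e_i$ if $v+e_i\in V_g$ and $\psi_i(v)=\bot$ otherwise. Then for every $i\in\{1,\dots,D\}$, $\psi_i$ is a pseudo-minimal translation on $G_g$. -/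

import Mathlib

/-! ### Transformations and translations on a graph

The element `⊥ ∉ V` is `none : Option V`, and `V ∪ {⊥}` is `Option V`. -/

/-- A transformation: a map `φ : V ∪ {⊥} → V ∪ {⊥}` with `φ ⊥ = ⊥`, injective on the set of
vertices whose image is not `⊥`. -/
structure GraphTransformation (V : Type*) where
  toFun : Option V → Option V
  map_bot : toFun none = none
  inj : ∀ v₁ v₂ : V, toFun (some v₁) ≠ none → toFun (some v₂) ≠ none →
    toFun (some v₁) = toFun (some v₂) → v₁ = v₂

namespace GraphTransformation

variable {V : Type*}

/-- The loss of a transformation: the number of vertices sent to `⊥`. -/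
noncomputable def loss [Finite V] (φ : GraphTransformation V) : ℕ :=
  {v : V | φ.toFun (some v) = none}.ncard

/-- Edge-constrained: every vertex with image in `V` is sent to one of its neighbours. -/
def IsEC (G : SimpleGraph V) (φ : GraphTransformation V) : Prop :=
  ∀ v w : V, φ.toFun (some v) = some w → G.Adj v w

/-- Strongly neighbourhood-preserving: two vertices with images in `V` are adjacent
if and only if their images are. -/
def IsSNP (G : SimpleGraph V) (φ : GraphTransformation V) : Prop :=
  ∀ v₁ v₂ w₁ w₂ : V, φ.toFun (some v₁) = some w₁ → φ.toFun (some v₂) = some w₂ →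
    (G.Adj v₁ v₂ ↔ G.Adj w₁ w₂)

/-- A translation on `G`: an edge-constrained, strongly neighbourhood-preserving
transformation. -/
def IsTranslation (G : SimpleGraph V) (φ : GraphTransformation V) : Prop :=
  φ.IsEC G ∧ φ.IsSNP G

/-- `Prec ψ₁ ψ₂` is `ψ₁ ≺ ψ₂`: the loss of `ψ₁` is strictly larger than that of `ψ₂`, and the two
have an edge `v → w` in common (agreeing on a vertex sent to `⊥` does not count). -/
def Prec [Finite V] (ψ₁ ψ₂ : GraphTransformation V) : Prop :=
  ψ₂.loss < ψ₁.loss ∧ ∃ v w : V, ψ₁.toFun (some v) = some w ∧ ψ₂.toFun (some v) = some w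

/-- A minimal translation: one for which there is no translation `ψ₂` with `ψ₁ ≺ ψ₂`. -/
def IsMinimal [Finite V] (G : SimpleGraph V) (ψ₁ : GraphTransformation V) : Prop :=
  ψ₁.IsTranslation G ∧ ¬ ∃ ψ₂ : GraphTransformation V, ψ₂.IsTranslation G ∧ Prec ψ₁ ψ₂

/-- Pseudo-minimal translations, defined by recursion on the loss: a translation `ψ₁` is
pseudo-minimal if it is minimal, or if no translation `ψ₂` with `ψ₁ ≺ ψ₂` is pseudo-minimal. -/
def IsPseudoMinimal [Finite V] (G : SimpleGraph V) (ψ₁ : GraphTransformation V) : Prop :=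
  ψ₁.IsTranslation G ∧
    (ψ₁.IsMinimal G ∨
      ∀ ψ₂ : GraphTransformation V, ψ₂.IsTranslation G → (_h : Prec ψ₁ ψ₂) →
        ¬ IsPseudoMinimal G ψ₂)
termination_by ψ₁.loss
decreasing_by exact _h.1

/-- The defining recursion of pseudo-minimality. -/
theorem isPseudoMinimal_iff [Finite V] (G : SimpleGraph V) (ψ₁ : GraphTransformation V) :
    ψ₁.IsPseudoMinimal G ↔ ψ₁.IsTranslation G ∧
      (ψ₁.IsMinimal G ∨
        ∀ ψ₂ : GraphTransformation V, ψ₂.IsTranslation G → Prec ψ₁ ψ₂ →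
          ¬ ψ₂.IsPseudoMinimal G) := by
  rw [IsPseudoMinimal]

end GraphTransformation

/-! ### Grid graphs -/

/-- The vertices of the grid with dimensions `d`: the integer points of
`⟦1, d 1⟧ × ⋯ × ⟦1, d D⟧`. The dimensions are indexed by `Fin D`. -/
abbrev GridVertex {D : ℕ} (d : Fin D → ℕ) : Type :=
  {v : Fin D → ℤ // ∀ i, 1 ≤ v i ∧ v i ≤ (d i : ℤ)}

instance instFiniteGridVertex {D : ℕ} (d : Fin D → ℕ) : Finite (GridVertex d) := by
  refine Set.Finite.to_subtype
    (Set.Finite.subset (Set.finite_Icc (fun _ => (1 : ℤ)) (fun i => (d i : ℤ))) ?_)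
  intro v hv
  exact ⟨fun i => (hv i).1, fun i => (hv i).2⟩

/-- The grid graph: two vertices are adjacent if they differ by exactly one in one coordinate and
agree in all the others. -/
def gridGraph {D : ℕ} (d : Fin D → ℕ) : SimpleGraph (GridVertex d) where
  Adj v w := ∃ i, |v.1 i - w.1 i| = 1 ∧ ∀ j, j ≠ i → v.1 j = w.1 j
  symm := ⟨by
    rintro v w ⟨i, h1, h2⟩
    exact ⟨i, by rwa [abs_sub_comm], fun j hj => (h2 j hj).symm⟩⟩
  loopless := ⟨by
    rintro v ⟨i, h1, -⟩
    simp at h1⟩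

/-- The Dirac vector of dimension `i`. -/
def diracVector {D : ℕ} (i : Fin D) : Fin D → ℤ := fun j => if j = i then 1 else 0

open Classical in
/-- The Euclidean translation by `δ` on the grid: `v ↦ v + δ` if `v + δ` lies in the grid, and
`v ↦ ⊥` otherwise. -/
noncomputable def euclideanTranslation {D : ℕ} (d : Fin D → ℕ) (δ : Fin D → ℤ) :
    GraphTransformation (GridVertex d) where
  toFun o := o.bind fun v =>
    if h : ∀ i, 1 ≤ (v.1 + δ) i ∧ (v.1 + δ) i ≤ (d i : ℤ) then some ⟨v.1 + δ, h⟩ else none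
  map_bot := rfl
  inj := by
    intro v w hv hw hvw
    simp only [Option.bind_some] at hv hw hvw
    split_ifs at hv hw hvw
    · simpa [Subtype.ext_iff] using hvw
    all_goals simp_all

/-- The growth assumption: the last dimension is at least `3`, and every other dimension is at
least `2` plus twice the product of the dimensions that follow it. -/
def IsLargeGrid {D : ℕ} (d : Fin D → ℕ) : Prop :=
  (∀ i : Fin D, (i : ℕ) + 1 = D → 3 ≤ d i) ∧
    ∀ i : Fin D, (i : ℕ) + 1 < D → 2 + 2 * ∏ j ∈ Finset.Ioi i, d j ≤ d i

/-! Strong induction on the axis `i`, for both directions `± e i`. Suppose a translation `ψ` has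
smaller loss than the Euclidean one along `i` and shares an edge with it. Let `j ≤ i` be the least
axis along which `ψ` moves some vertex. Then `ψ` loses at least as much as the Euclidean translation
along `j`, with equality only if every motion is along `j` (`card_slab_le_card_lostVertices`). So `j
≠ i`; and as `ψ` also moves a vertex along `i`, its loss is strictly larger. Hence `ψ` is dominated
by a Euclidean translation along `j < i`, pseudo-minimal by induction, and `ψ` is not
pseudo-minimal.

For the loss bound, `ψ` preserves each block obtained by freezing the coordinates before `j`, so
blocks are treated separately and summed. In a block the axis `j` is long compared with a slice
orthogonal to it. If the loss is at most one slice, two consecutive slices lose nothing. Local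
rigidity (`forward`, `not_move`) then makes each of them move as a whole along `j`. If they move the
same way, counting vertices ahead of them shows that a full slice is lost and that all motions are
along `j`. If they are exchanged, the neighbouring slices are lost entirely; another lossless pair
then exists, and two exchanges would cost two slices. -/

/-! ### Unit vectors of the integer lattice -/

section UnitVectors

variable {ι : Type*} [DecidableEq ι]

/-- The vectors `± e i` of the integer lattice. -/
def IsUnitVec (u : ι → ℤ) : Prop :=
  ∃ i, ∃ s : ℤ, (s = 1 ∨ s = -1) ∧ u = Pi.single i s

theorem isUnitVec_single (i : ι) {s : ℤ} (hs : s = 1 ∨ s = -1) :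
    IsUnitVec (Pi.single i s : ι → ℤ) :=
  ⟨i, s, hs, rfl⟩

theorem IsUnitVec.neg {u : ι → ℤ} (hu : IsUnitVec u) : IsUnitVec (-u) := by
  obtain ⟨i, s, hs, rfl⟩ := hu
  exact ⟨i, -s, by omega, by rw [Pi.single_neg]⟩

theorem isUnitVec_sub_comm {v w : ι → ℤ} : IsUnitVec (v - w) ↔ IsUnitVec (w - v) := by
  constructor <;> intro h <;> simpa using h.neg

theorem IsUnitVec.ne_neg {u : ι → ℤ} (hu : IsUnitVec u) : u ≠ -u := by
  obtain ⟨i, s, hs, rfl⟩ := hu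
  intro h
  have := congrFun h i
  simp at this
  omega

/-- A sum of two unit vectors determines its terms, unless it vanishes. -/
theorem IsUnitVec.add_eq_add {a b c d : ι → ℤ} (ha : IsUnitVec a) (hb : IsUnitVec b)
    (hc : IsUnitVec c) (hd : IsUnitVec d) (h : a + b = c + d) : a = c ∨ a = d ∨ b = -a := by
  obtain ⟨i, s, hs, rfl⟩ := ha
  obtain ⟨j, t, ht, rfl⟩ := hb
  obtain ⟨k, p, hp, rfl⟩ := hc
  obtain ⟨l, q, hq, rfl⟩ := hd
  have hi := congrFun h i
  by_cases hij : j = i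
  · subst hij
    by_cases hst : t = -s
    · right; right; rw [hst, Pi.single_neg]
    · simp only [Pi.add_apply, Pi.single_apply, if_true] at hi
      have hk : j = k ∧ s = p := by
        split_ifs at hi <;> first | omega | skip
        refine ⟨by assumption, by omega⟩
      left; rw [hk.1, hk.2]
  · simp only [Pi.add_apply, Pi.single_apply, if_true, if_neg (Ne.symm hij)] at hi
    by_cases hk : i = k
    · by_cases hl : i = l
      · exfalso
        simp only [if_pos hk, if_pos hl] at hi
        omega
      · simp only [if_pos hk, if_neg hl] at hi
        left; rw [hk]; congr 1; omega
    · by_cases hl : i = l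
      · simp only [if_neg hk, if_pos hl] at hi
        right; left; rw [hl]; congr 1; omega
      · simp only [if_neg hk, if_neg hl] at hi
        omega

end UnitVectors

/-! ### Translations of boxes in the integer lattice -/

/-- The relation `R` is the graph of a translation of the box `[lo, hi]`: a partial injection that
moves every vertex by a unit vector and preserves and reflects adjacency. -/
structure IsBoxTranslation {ι : Type*} [Fintype ι] [DecidableEq ι] (lo hi : ι → ℤ)
    (R : (ι → ℤ) → (ι → ℤ) → Prop) : Prop where
  mem_left : ∀ {v w}, R v w → v ∈ Finset.Icc lo hi
  mem_right : ∀ {v w}, R v w → w ∈ Finset.Icc lo hi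
  functional : ∀ {v w w'}, R v w → R v w' → w = w'
  injective : ∀ {v v' w}, R v w → R v' w → v = v'
  unit : ∀ {v w}, R v w → IsUnitVec (w - v)
  adj_iff : ∀ {v v' w w'}, R v w → R v' w' → (IsUnitVec (v' - v) ↔ IsUnitVec (w' - w))

open Classical in
/-- The vertices of the box `[lo, hi]` at which the relation `R` is undefined. -/
noncomputable def lostVertices {ι : Type*} [Fintype ι] [DecidableEq ι] (lo hi : ι → ℤ)
    (R : (ι → ℤ) → (ι → ℤ) → Prop) : Finset (ι → ℤ) :=
  {v ∈ Finset.Icc lo hi | ¬ ∃ w, R v w}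

theorem mem_lostVertices {ι : Type*} [Fintype ι] [DecidableEq ι] {lo hi : ι → ℤ}
    {R : (ι → ℤ) → (ι → ℤ) → Prop} {v : ι → ℤ} :
    v ∈ lostVertices lo hi R ↔ v ∈ Finset.Icc lo hi ∧ ¬ ∃ w, R v w := by
  simp [lostVertices]

/-! ### Local rigidity of box translations -/

section Box

variable {ι : Type*} [Fintype ι] [DecidableEq ι] {lo hi : ι → ℤ}
  {R : (ι → ℤ) → (ι → ℤ) → Prop}

theorem mem_Icc_pi {v : ι → ℤ} : v ∈ Finset.Icc lo hi ↔ ∀ i, lo i ≤ v i ∧ v i ≤ hi i := by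
  simp [Finset.mem_Icc, Pi.le_def, forall_and]

theorem add_single_mem_Icc {v : ι → ℤ} (hv : v ∈ Finset.Icc lo hi) {i : ι} {s : ℤ}
    (h₁ : lo i ≤ v i + s) (h₂ : v i + s ≤ hi i) : v + Pi.single i s ∈ Finset.Icc lo hi := by
  rw [mem_Icc_pi] at hv ⊢
  intro k
  rcases eq_or_ne k i with rfl | hk
  · simpa using ⟨h₁, h₂⟩
  · simpa [hk] using hv k

namespace IsBoxTranslation

/-- The conditions are symmetric in source and target; this turns statements about images and
backward motions into forward ones. -/
protected theorem flip (h : IsBoxTranslation lo hi R) : IsBoxTranslation lo hi (flip R) where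
  mem_left := h.mem_right
  mem_right := h.mem_left
  functional := h.injective
  injective := h.functional
  unit h' := isUnitVec_sub_comm.1 (h.unit h')
  adj_iff h₁ h₂ := (h.adj_iff h₁ h₂).symm

/-- Adjacent vertices move in parallel, unless one of them moves to the other. -/
theorem parallel_or_follow (h : IsBoxTranslation lo hi R) {v w v' w' : ι → ℤ}
    (hv : R v w) (hv' : R v' w') (hu : IsUnitVec (v' - v)) :
    w - v = w' - v' ∨ w = v' ∨ w' = v := by
  have h₁ := (h.adj_iff hv hv').1 hu
  -- Going from `v` to `w'` through `w` or through `v'` writes one vector in two ways as a sum of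
  -- two unit vectors.
  rcases (h.unit hv).add_eq_add h₁ hu (h.unit hv') (by abel) with h₂ | h₂ | h₂
  · exact Or.inr (Or.inl (sub_left_injective h₂))
  · exact Or.inl h₂
  · right; right
    have : w' = w - (w - v) := by rw [sub_eq_add_neg w (w - v), ← h₂]; abel
    simpa using this

/-- The vertex behind a moving vertex can only follow it. -/
theorem eq_of_behind (h : IsBoxTranslation lo hi R) {p q c w : ι → ℤ} (hp : R p q)
    (hc : q = p + c) (hw : R (p - c) w) : w = p := by
  subst hc
  have hu : IsUnitVec c := by simpa using h.unit hp
  rcases h.parallel_or_follow hw hp (by simpa using hu) with h₁ | h₁ | h₁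
  · have : w = (w - (p - c)) + (p - c) := by abel
    rw [this, h₁]; abel
  · exact h₁
  · exfalso
    apply hu.ne_neg
    have : p + c - p = p - c - p := by rw [h₁]
    simpa using this

/-- Two vertices with a further vertex on their line are not exchanged. -/
theorem not_swap (h : IsBoxTranslation lo hi R) {v a : ι → ℤ} (ha : IsUnitVec a)
    (h₁ : R v (v + a)) (h₂ : R (v + a) v)
    (h₃ : (∃ w, R (v - a) w) ∨ ∃ w, R (v + a + a) w) : False := by
  rcases h₃ with ⟨w, hw⟩ | ⟨w, hw⟩
  · have h₄ := h.eq_of_behind h₁ rfl hw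
    subst h₄
    have h₅ := h.injective hw h₂
    exact ha.ne_neg (by simpa [sub_eq_add_neg] using h₅.symm)
  · have h₄ := h.eq_of_behind h₂ (c := -a) (by abel) (by simpa using hw)
    subst h₄
    have h₅ : v + a + a = v := h.injective hw h₁
    rw [add_assoc, add_eq_left] at h₅
    exact ha.ne_neg (eq_neg_of_add_eq_zero_left h₅)

/-- A square with a further vertex on the line of one of its sides does not rotate. -/
theorem not_rotate (h : IsBoxTranslation lo hi R) {v a u : ι → ℤ}
    (h₁ : R v (v + a)) (h₂ : R (v + a) (v + a + u)) (h₃ : R (v + a + u) (v + u))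
    (h₄ : R (v + u) v) (hua : u ≠ -a)
    (h₅ : (∃ w, R (v - a) w) ∨ ∃ w, R (v + a + u + a) w) : False := by
  rcases h₅ with ⟨w, hw⟩ | ⟨w, hw⟩
  · have h₆ := h.eq_of_behind h₁ rfl hw
    subst h₆
    have h₇ := h.injective hw h₄
    rw [sub_eq_add_neg, add_right_inj] at h₇
    exact hua h₇.symm
  · have h₆ := h.eq_of_behind h₃ (c := -a) (by abel) (by simpa using hw)
    subst h₆
    have h₇ := h.injective hw h₂
    rw [add_assoc, add_eq_left] at h₇
    exact hua (eq_neg_of_add_eq_zero_left h₇)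

/-- In a box on which a translation is defined everywhere, a motion in a direction in which the box
is full and of width at least three goes on. -/
theorem forward (h : IsBoxTranslation lo hi R) {lo' hi' : ι → ℤ} {j : ι}
    (hdom : ∀ v ∈ Finset.Icc lo' hi', ∃ w, R v w)
    (hlo : lo' j = lo j) (hhi : hi' j = hi j) (hw : lo j + 2 ≤ hi j)
    (hside : ∀ i, i ≠ j → (lo' i = lo i ∧ hi' i = hi i) ∨ lo' i < hi' i)
    {v : ι → ℤ} {s : ℤ} (hs : s = 1 ∨ s = -1) (hv : v ∈ Finset.Icc lo' hi')
    (hR : R v (v + Pi.single j s)) :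
    v + Pi.single j s ∈ Finset.Icc lo' hi' ∧
      R (v + Pi.single j s) (v + Pi.single j s + Pi.single j s) := by
  have hm := mem_Icc_pi.1 (h.mem_right hR)
  have hvj := mem_Icc_pi.1 hv j
  have hmj := hm j
  simp only [Pi.add_apply, Pi.single_eq_same] at hmj
  have hva : v + Pi.single j s ∈ Finset.Icc lo' hi' :=
    add_single_mem_Icc hv (by omega) (by omega)
  refine ⟨hva, ?_⟩
  have hsub : v - Pi.single j s = v + Pi.single j (-s) := by rw [Pi.single_neg]; abel
  set a : ι → ℤ := Pi.single j s with ha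
  have hua : IsUnitVec a := isUnitVec_single j hs
  have hvaj : (v + a) j = v j + s := by simp [ha]
  -- Width at least three: the line through `v` and `v + a` has a third vertex in the inner box, as
  -- `not_swap` and `not_rotate` require.
  have hthird : v - a ∈ Finset.Icc lo' hi' ∨ lo' j ≤ v j + s + s ∧ v j + s + s ≤ hi' j := by
    by_cases h1 : lo' j ≤ v j + s + s ∧ v j + s + s ≤ hi' j
    · exact Or.inr h1
    · left
      rw [hsub]
      exact add_single_mem_Icc hv (by omega) (by omega)
  obtain ⟨x, hx⟩ := hdom _ hva
  obtain ⟨i, t, ht, hxt⟩ := h.unit hx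
  have hx' : x = v + a + Pi.single i t := by rw [← hxt]; abel
  subst hx'
  clear hxt
  by_cases hij : i = j
  · subst hij
    by_cases hts : t = s
    · subst hts; exact hx
    exfalso
    have hta : (Pi.single i t : ι → ℤ) = -a := by
      rw [show t = -s by omega, Pi.single_neg]
    rw [hta] at hx
    refine h.not_swap hua hR (by simpa using hx) ?_
    refine hthird.imp (fun h3 => hdom _ h3) (fun h3 => hdom _ ?_)
    exact add_single_mem_Icc hva (by omega) (by omega)
  · exfalso
    have hvi : (v + a) i = v i := by simp [ha, hij]
    have hmx := mem_Icc_pi.1 (h.mem_right hx) i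
    simp only [Pi.add_apply, Pi.single_eq_same] at hmx
    rw [← Pi.add_apply, hvi] at hmx
    have hvi' := mem_Icc_pi.1 hv i
    have hsubu : v + a - Pi.single i t = v + a + Pi.single i (-t) := by rw [Pi.single_neg]; abel
    have huai : (Pi.single i t : ι → ℤ) ≠ -a ∧ (Pi.single i t : ι → ℤ) ≠ a := by
      constructor <;> intro h0 <;> have := congrFun h0 i <;>
        simp [ha, hij] at this <;> omega
    -- A vertex behind the turning one would have to follow it to `v + a`, which is already the
    -- image of `v`.
    have hbehind : v + a - Pi.single i t ∉ Finset.Icc lo' hi' := by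
      intro h0
      obtain ⟨y, hy⟩ := hdom _ h0
      have hya := h.eq_of_behind hx rfl hy
      subst hya
      have := h.injective hy hR
      rw [add_sub_assoc, add_eq_left, sub_eq_zero] at this
      exact huai.2 this.symm
    -- If the inner box is full along `i`, it contains the target's coordinate; otherwise it has
    -- width at least two there, and since the vertex behind is outside, the one ahead is inside.
    have hside' : lo' i ≤ v i + t ∧ v i + t ≤ hi' i := by
      by_contra hc
      apply hbehind
      rw [hsubu]
      have := hside i hij
      exact add_single_mem_Icc hva (by rw [hvi]; omega) (by rw [hvi]; omega)
    have hq : v + Pi.single i t ∈ Finset.Icc lo' hi' :=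
      add_single_mem_Icc hv hside'.1 hside'.2
    have hq' : v + a + Pi.single i t ∈ Finset.Icc lo' hi' :=
      add_single_mem_Icc hva (by rw [hvi]; exact hside'.1) (by rw [hvi]; exact hside'.2)
    have hqa : (v + a + (Pi.single i t : ι → ℤ)) j = v j + s := by
      simp [ha, Ne.symm hij]
    set u : ι → ℤ := Pi.single i t with hu
    have huu : IsUnitVec u := isUnitVec_single i ht
    obtain ⟨y, hy⟩ := hdom _ hq
    obtain ⟨y', hy'⟩ := hdom _ hq'
    have hyv : y = v := by
      rcases h.parallel_or_follow hR hy (by simpa using huu) with h1 | h1 | h1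
      · have h2 : y = v + a + u := by
          have : y = (y - (v + u)) + (v + u) := by abel
          rw [this, ← h1]; abel
        subst h2
        have : v + u = v + a := h.injective hy hx
        exact absurd (add_left_cancel this) huai.2
      · exact absurd (add_left_cancel h1).symm huai.2
      · exact h1
    subst hyv
    have hy'q : y' = y + u := by
      rcases h.parallel_or_follow hy hy' (by simpa [add_assoc, add_sub_add_left_eq_sub] using hua) with
        h1 | h1 | h1
      · exfalso
        have h2 : y' = y + a := by
          have : y' = (y' - (y + a + u)) + (y + a + u) := by abel
          rw [this, ← h1]; abel
        subst h2
        have := h.injective hy' hR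
        rw [add_assoc, add_eq_left] at this
        exact huai.1 (eq_neg_of_add_eq_zero_right this)
      · exfalso
        have := h1.symm
        rw [add_assoc, add_eq_left] at this
        exact huai.1 (eq_neg_of_add_eq_zero_right this)
      · exact h1
    subst hy'q
    -- The turn has forced the four corners of the unit square to rotate, which the third vertex on
    -- the line excludes.
    refine h.not_rotate hR hx hy' hy huai.1 ?_
    refine hthird.imp (fun h3 => hdom _ h3) (fun h3 => hdom _ ?_)
    exact add_single_mem_Icc hq' (by omega) (by omega)

/-- In a box on which a translation is defined everywhere, nothing moves in a direction in which
the box is full and of width at least three. -/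
theorem not_move (h : IsBoxTranslation lo hi R) {lo' hi' : ι → ℤ} {j : ι}
    (hdom : ∀ v ∈ Finset.Icc lo' hi', ∃ w, R v w)
    (hlo : lo' j = lo j) (hhi : hi' j = hi j) (hw : lo j + 2 ≤ hi j)
    (hside : ∀ i, i ≠ j → (lo' i = lo i ∧ hi' i = hi i) ∨ lo' i < hi' i)
    {v : ι → ℤ} {s : ℤ} (hs : s = 1 ∨ s = -1) (hv : v ∈ Finset.Icc lo' hi') :
    ¬ R v (v + Pi.single j s) := by
  intro hR
  have key : ∀ n : ℕ, v + n • (Pi.single j s : ι → ℤ) ∈ Finset.Icc lo' hi' ∧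
      R (v + n • (Pi.single j s : ι → ℤ)) (v + n • (Pi.single j s : ι → ℤ) + Pi.single j s) := by
    intro n
    induction n with
    | zero => simpa using ⟨Finset.mem_Icc.1 hv, hR⟩
    | succ n ih =>
      rw [succ_nsmul, ← add_assoc]
      exact h.forward hdom hlo hhi hw hside hs ih.1 ih.2
  -- One more step than the difference of the two bounds takes the vertex out of the box.
  have h1 := mem_Icc_pi.1 (key (hi j - lo j + 1).toNat).1 j
  have h2 := mem_Icc_pi.1 hv j
  have h3 : ∀ n : ℕ, (n • (Pi.single j s : ι → ℤ)) j = n * s := by simp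
  rw [Pi.add_apply, h3] at h1
  rcases hs with rfl | rfl <;> omega

end IsBoxTranslation
end Box

/-- Every motion of `R` is along the axis `i`. -/
def MovesAlong {ι : Type*} [DecidableEq ι] (R : (ι → ℤ) → (ι → ℤ) → Prop) (i : ι) : Prop :=
  ∀ v w, R v w → ∃ s : ℤ, (s = 1 ∨ s = -1) ∧ w = v + Pi.single i s

theorem MovesAlong.of_flip {ι : Type*} [DecidableEq ι] {R : (ι → ℤ) → (ι → ℤ) → Prop} {i : ι}
    (h : MovesAlong (flip R) i) : MovesAlong R i := by
  intro v w hvw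
  obtain ⟨s, hs, rfl⟩ := h w v hvw
  exact ⟨-s, by omega, by rw [Pi.single_neg]; abel⟩

/-! ### Slabs and slices orthogonal to an axis -/

section Slabs

variable {ι : Type*} [Fintype ι] [DecidableEq ι] {lo hi : ι → ℤ}
  {R : (ι → ℤ) → (ι → ℤ) → Prop}

/-- A property that passes between adjacent vertices of a box holds on the whole box if it holds
somewhere. -/
theorem Icc_pi_induction {P : (ι → ℤ) → Prop}
    (hP : ∀ v ∈ Finset.Icc lo hi, ∀ (j : ι) (s : ℤ), (s = 1 ∨ s = -1) →
      v + Pi.single j s ∈ Finset.Icc lo hi → P v → P (v + Pi.single j s))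
    {v : ι → ℤ} (hv : v ∈ Finset.Icc lo hi) (hPv : P v) :
    ∀ v' ∈ Finset.Icc lo hi, P v' := by
  -- Induction on the ℓ¹ distance to `v`, each step decreasing it inside the box.
  suffices H : ∀ n : ℕ, ∀ v' ∈ Finset.Icc lo hi, ∑ j, (v' j - v j).natAbs = n → P v' from
    fun v' hv' => H _ v' hv' rfl
  intro n
  induction n using Nat.strong_induction_on with
  | _ n ih =>
    intro v' hv' hn
    by_cases hvv : v' = v
    · rwa [hvv]
    obtain ⟨j, hj⟩ := Function.ne_iff.1 hvv
    have hvj := mem_Icc_pi.1 hv j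
    have hvj' := mem_Icc_pi.1 hv' j
    obtain ⟨s, hs, hs'⟩ : ∃ s : ℤ, (s = 1 ∨ s = -1) ∧
        (v' j + -s - v j).natAbs < (v' j - v j).natAbs ∧ lo j ≤ v' j + -s ∧ v' j + -s ≤ hi j := by
      rcases lt_or_gt_of_ne hj with h | h
      · exact ⟨-1, by omega, by omega⟩
      · exact ⟨1, by omega, by omega⟩
    have hm : v' + Pi.single j (-s) ∈ Finset.Icc lo hi := add_single_mem_Icc hv' hs'.2.1 hs'.2.2
    have hlt : ∑ l, ((v' + (Pi.single j (-s) : ι → ℤ)) l - v l).natAbs < n := by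
      rw [← hn]
      refine Finset.sum_lt_sum (fun l _ => ?_) ⟨j, Finset.mem_univ _, by simpa using hs'.1⟩
      rcases eq_or_ne l j with rfl | hl
      · simpa using hs'.1.le
      · simp [hl]
    have e : v' + Pi.single j (-s) + Pi.single j s = v' := by rw [Pi.single_neg]; abel
    have := hP _ hm j s hs (by rwa [e]) (ih _ hlt _ hm rfl)
    rwa [e] at this

/-- The part of the box `[lo, hi]` with `i`-th coordinate between `k` and `l`. -/
noncomputable def slab (lo hi : ι → ℤ) (i : ι) (k l : ℤ) : Finset (ι → ℤ) :=
  Finset.Icc (Function.update lo i k) (Function.update hi i l)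

theorem mem_slab {i : ι} {k l : ℤ} {v : ι → ℤ} :
    v ∈ slab lo hi i k l ↔ (∀ j, j ≠ i → lo j ≤ v j ∧ v j ≤ hi j) ∧ k ≤ v i ∧ v i ≤ l := by
  rw [slab, mem_Icc_pi]
  constructor
  · intro h
    exact ⟨fun j hj => by simpa [hj] using h j, by simpa using h i⟩
  · rintro ⟨h, h'⟩ j
    rcases eq_or_ne j i with rfl | hj
    · simpa using h'
    · simpa [hj] using h j hj

theorem mem_slab_iff {i : ι} {k l : ℤ} (hk : lo i ≤ k) (hl : l ≤ hi i) {v : ι → ℤ} :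
    v ∈ slab lo hi i k l ↔ v ∈ Finset.Icc lo hi ∧ k ≤ v i ∧ v i ≤ l := by
  rw [mem_slab, mem_Icc_pi]
  constructor
  · rintro ⟨h, h'⟩
    refine ⟨fun j => ?_, h'⟩
    rcases eq_or_ne j i with rfl | hj
    · omega
    · exact h j hj
  · rintro ⟨h, h'⟩
    exact ⟨fun j _ => h j, h'⟩

theorem card_slab (i : ι) (k l : ℤ) :
    (slab lo hi i k l).card =
      (l + 1 - k).toNat * ∏ j ∈ Finset.univ.erase i, (hi j + 1 - lo j).toNat := by
  rw [slab, Pi.card_Icc, ← Finset.mul_prod_erase _ _ (Finset.mem_univ i)]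
  congr 1
  · simp
  · refine Finset.prod_congr rfl fun j hj => ?_
    simp [Finset.ne_of_mem_erase hj]

theorem card_slice (i : ι) (k l : ℤ) :
    (slab lo hi i k k).card = (slab lo hi i l l).card := by
  rw [card_slab, card_slab]
  simp

namespace IsBoxTranslation

/-- On a slab of width at least two on which a translation is defined everywhere, all motions are
across the slab. -/
theorem moves_across_slab (h : IsBoxTranslation lo hi R) {i : ι}
    (hside : ∀ j, j ≠ i → lo j = hi j ∨ lo j + 2 ≤ hi j) {k l : ℤ} (hkl : k < l)
    (hdom : ∀ v ∈ slab lo hi i k l, ∃ w, R v w) {v w : ι → ℤ} (hv : v ∈ slab lo hi i k l)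
    (hR : R v w) : ∃ s : ℤ, (s = 1 ∨ s = -1) ∧ w = v + Pi.single i s := by
  obtain ⟨j, s, hs, hws⟩ := h.unit hR
  have hw : w = v + Pi.single j s := by rw [← hws]; abel
  subst hw
  rcases eq_or_ne j i with rfl | hj
  · exact ⟨s, hs, rfl⟩
  exfalso
  rcases hside j hj with hj' | hj'
  · have h1 := mem_Icc_pi.1 (h.mem_left hR) j
    have h2 := mem_Icc_pi.1 (h.mem_right hR) j
    simp only [Pi.add_apply, Pi.single_eq_same] at h2
    omega
  -- The slab is full along every axis other than `i` and has width at least two along `i`, as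
  -- `not_move` asks.
  · refine h.not_move hdom (by simp [hj]) (by simp [hj]) hj' (fun l' hl' => ?_) hs hv hR
    rcases eq_or_ne l' i with rfl | hl
    · right; simpa using hkl
    · left; simp [hl]

/-- On a slab on which a translation is defined everywhere, each slice moves as a whole. -/
theorem exists_slice_motion (h : IsBoxTranslation lo hi R) {i : ι}
    (hbox : ∀ j, lo j ≤ hi j)
    (hside : ∀ j, j ≠ i → lo j = hi j ∨ lo j + 2 ≤ hi j) {k l m : ℤ} (hkl : k < l)
    (hdom : ∀ v ∈ slab lo hi i k l, ∃ w, R v w) (hkm : k ≤ m) (hml : m ≤ l) :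
    ∃ s : ℤ, (s = 1 ∨ s = -1) ∧ ∀ v ∈ slab lo hi i m m, R v (v + Pi.single i s) := by
  have hsub : ∀ v ∈ slab lo hi i m m, v ∈ slab lo hi i k l := fun v hv => by
    rw [mem_slab] at hv ⊢
    exact ⟨hv.1, by omega, by omega⟩
  have hv₀ : Function.update lo i m ∈ slab lo hi i m m := by
    rw [mem_slab]
    exact ⟨fun j hj => by simp [hj, hbox j], by simp⟩
  obtain ⟨w, hw⟩ := hdom _ (hsub _ hv₀)
  obtain ⟨s, hs, rfl⟩ := h.moves_across_slab hside hkl hdom (hsub _ hv₀) hw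
  refine ⟨s, hs, ?_⟩
  unfold slab at hv₀ ⊢
  refine Icc_pi_induction (P := fun v => R v (v + Pi.single i s)) ?_ hv₀ hw
  change ∀ v ∈ slab lo hi i m m, ∀ j t, _ → _ ∈ slab lo hi i m m → _
  intro v hv j t ht hv' hR
  have hji : j ≠ i := by
    rintro rfl
    have h1 := (mem_slab.1 hv).2
    have h2 := (mem_slab.1 hv').2
    simp only [Pi.add_apply, Pi.single_eq_same] at h2
    omega
  obtain ⟨w', hw'⟩ := hdom _ (hsub _ hv')
  obtain ⟨s', hs', rfl⟩ := h.moves_across_slab hside hkl hdom (hsub _ hv') hw'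
  -- Neighbours within a slice differ along `j ≠ i` but move along `i`, so neither moves to the
  -- other and they move in parallel.
  rcases h.parallel_or_follow hR hw' (by simpa using isUnitVec_single j ht) with h1 | h1 | h1
  · have h2 := congrFun h1 i
    simp only [add_sub_cancel_left, Pi.single_eq_same] at h2
    rwa [h2]
  · have h2 := congrFun h1 i
    simp [Ne.symm hji] at h2
    omega
  · have h2 := congrFun h1 i
    simp [Ne.symm hji] at h2
    omega

-- `R` injects its domain into its range, so inside the same box the complement of the range is no
-- larger than that of the domain.
open Classical in
theorem card_lostVertices_flip_le (h : IsBoxTranslation lo hi R) :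
    (lostVertices lo hi (flip R)).card ≤ (lostVertices lo hi R).card := by
  have h1 := Finset.card_filter_add_card_filter_not (s := Finset.Icc lo hi) (fun v => ∃ w, R v w)
  have h2 := Finset.card_filter_add_card_filter_not (s := Finset.Icc lo hi)
    (fun v => ∃ w, flip R v w)
  have h3 : ({v ∈ Finset.Icc lo hi | ∃ w, R v w}).card ≤
      ({v ∈ Finset.Icc lo hi | ∃ w, flip R v w}).card := by
    refine Finset.card_le_card_of_forall_subsingleton R (fun v hv => ?_) (fun w _ v hv v' hv' => ?_)
    · obtain ⟨w, hw⟩ := (Finset.mem_filter.1 hv).2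
      exact ⟨w, Finset.mem_filter.2 ⟨h.mem_right hw, v, hw⟩, hw⟩
    · exact h.injective hv.2 hv'.2
  simp only [lostVertices]
  omega

theorem card_lostVertices_flip (h : IsBoxTranslation lo hi R) :
    (lostVertices lo hi (flip R)).card = (lostVertices lo hi R).card :=
  le_antisymm h.card_lostVertices_flip_le h.flip.card_lostVertices_flip_le

end IsBoxTranslation
end Slabs

/-! ### Small loss forces motion along a long axis -/

section Slabs

variable {ι : Type*} [Fintype ι] [DecidableEq ι] {lo hi : ι → ℤ}
  {R : (ι → ℤ) → (ι → ℤ) → Prop}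

namespace IsBoxTranslation

open Classical in
/-- If two consecutive slices move forward and the loss is at most the size of a slice, then the
loss is the size of a slice and all motions are along the axis. -/
theorem movesAlong_of_forward_slices (h : IsBoxTranslation lo hi R) {i : ι}
    (hbox : ∀ j, lo j ≤ hi j) (hside : ∀ j, j ≠ i → lo j = hi j ∨ lo j + 2 ≤ hi j) {k : ℤ}
    (hlk : lo i ≤ k) (hk : ∀ v ∈ slab lo hi i k (k + 1), R v (v + Pi.single i 1))
    (hloss : (lostVertices lo hi R).card ≤ (slab lo hi i k k).card) :
    (slab lo hi i k k).card ≤ (lostVertices lo hi R).card ∧ MovesAlong R i := by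
  have hne : Function.update lo i (k + 1) ∈ slab lo hi i k (k + 1) := by
    rw [mem_slab]
    exact ⟨fun j hj => by simp [hj, hbox j], by simp, by simp⟩
  have hkh : k + 2 ≤ hi i := by
    have := (mem_Icc_pi.1 (h.mem_right (hk _ hne)) i).2
    simp at this
    omega
  set A := slab lo hi i (k + 1) (hi i) with hA
  set A' := slab lo hi i (k + 2) (hi i) with hA'
  have mA : ∀ {v}, v ∈ A ↔ v ∈ Finset.Icc lo hi ∧ k + 1 ≤ v i ∧ v i ≤ hi i :=
    fun {v} => mem_slab_iff (by omega) le_rfl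
  have mA' : ∀ {v}, v ∈ A' ↔ v ∈ Finset.Icc lo hi ∧ k + 2 ≤ v i ∧ v i ≤ hi i :=
    fun {v} => mem_slab_iff (by omega) le_rfl
  have mk : ∀ {v}, v ∈ slab lo hi i k (k + 1) ↔ v ∈ Finset.Icc lo hi ∧ k ≤ v i ∧ v i ≤ k + 1 :=
    fun {v} => mem_slab_iff hlk (by omega)
  have hcard : A.card = (slab lo hi i k k).card + A'.card := by
    rw [hA, hA', card_slab, card_slab, card_slab, ← add_mul]
    congr 1
    omega
  -- the slice `k + 1` is the image of the slice `k`
  have himage : ∀ w ∈ Finset.Icc lo hi, w i = k + 1 → R (w - Pi.single i 1) w := by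
    intro w hw hwi
    have hm : w + Pi.single i (-1) ∈ Finset.Icc lo hi :=
      add_single_mem_Icc hw (by omega) (by omega)
    have := hk (w + Pi.single i (-1)) (mk.2 ⟨hm, by simp; omega, by simp; omega⟩)
    rw [Pi.single_neg] at this
    simpa [sub_eq_add_neg] using this
  set domA := {v ∈ A | ∃ w, R v w} with hdomA
  set lostA := {v ∈ A | ¬ ∃ w, R v w} with hlostA
  have hsum : domA.card + lostA.card = A.card := Finset.card_filter_add_card_filter_not _
  -- The slice `k + 1` is already filled by the slice `k`, so by injectivity nothing else from `A`
  -- can enter it, let alone cross it. As `A` is one slice larger than `A'`, a slice's worth of `A`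
  -- is lost.
  have hmaps : ∀ v ∈ A, ∀ w, R v w → w ∈ A' := by
    intro v hv w hw
    have hv' := mA.1 hv
    have hwm := h.mem_right hw
    have hwi := mem_Icc_pi.1 hwm i
    rcases eq_or_lt_of_le hv'.2.1 with h1 | h1
    · have := h.functional hw (hk v (mk.2 ⟨hv'.1, by omega, by omega⟩))
      subst this
      exact mA'.2 ⟨hwm, by simp; omega, hwi.2⟩
    · obtain ⟨j, s, hs, hws⟩ := h.unit hw
      have hji : v i - 1 ≤ w i := by
        have := congrFun hws i
        rw [Pi.sub_apply, Pi.single_apply] at this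
        split_ifs at this <;> omega
      refine mA'.2 ⟨hwm, ?_, hwi.2⟩
      by_contra hc
      have hw1 : w i = k + 1 := by omega
      have := h.injective hw (himage w hwm hw1)
      subst this
      simp at h1
      omega
  choose! f hf using fun v (hv : v ∈ domA) => (Finset.mem_filter.1 hv).2
  have hfinj : Set.InjOn f domA := fun v hv v' hv' hvv =>
    h.injective (hf v hv) (by rw [hvv]; exact hf v' hv')
  have hsub : domA.image f ⊆ A' := by
    intro w hw
    obtain ⟨v, hv, rfl⟩ := Finset.mem_image.1 hw
    exact hmaps v (Finset.mem_filter.1 hv).1 _ (hf v hv)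
  have hle := Finset.card_le_card hsub
  have hci := Finset.card_image_of_injOn hfinj
  have hlost : lostA ⊆ lostVertices lo hi R := fun v hv => by
    have := Finset.mem_filter.1 hv
    exact mem_lostVertices.2 ⟨(mA.1 this.1).1, this.2⟩
  have hle' := Finset.card_le_card hlost
  refine ⟨by omega, ?_⟩
  -- Equality in the count: all losses lie in `A`, and all of `A'` is attained. So `R` is defined
  -- everywhere on the left part and its inverse on the right part.
  have hlostEq : lostA = lostVertices lo hi R := Finset.eq_of_subset_of_card_le hlost (by omega)
  have himEq : domA.image f = A' := Finset.eq_of_subset_of_card_le hsub (by omega)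
  have hleft : ∀ v ∈ slab lo hi i (lo i) (k + 1), ∃ w, R v w := by
    intro v hv
    rw [mem_slab_iff le_rfl (by omega)] at hv
    by_contra hc
    have h1 : v ∈ lostA := hlostEq ▸ mem_lostVertices.2 ⟨hv.1, hc⟩
    have h2 := mA.1 (Finset.mem_filter.1 h1).1
    exact hc ⟨_, hk v (mk.2 ⟨hv.1, by omega, by omega⟩)⟩
  have hright : ∀ w ∈ slab lo hi i (k + 1) (hi i), ∃ v, flip R w v := by
    intro w hw
    have hw' := mA.1 hw
    rcases eq_or_lt_of_le hw'.2.1 with h1 | h1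
    · exact ⟨_, himage w hw'.1 h1.symm⟩
    · have : w ∈ domA.image f := himEq ▸ mA'.2 ⟨hw'.1, by omega, hw'.2.2⟩
      obtain ⟨v, hv, rfl⟩ := Finset.mem_image.1 this
      exact ⟨v, hf v hv⟩
  intro v w hvw
  have hvm := h.mem_left hvw
  have hvi := mem_Icc_pi.1 hvm i
  rcases le_or_gt (v i) (k + 1) with h1 | h1
  · exact h.moves_across_slab hside (by omega) hleft
      ((mem_slab_iff le_rfl (by omega)).2 ⟨hvm, by omega, h1⟩) hvw
  · have hwA := mA'.1 (hmaps v (mA.2 ⟨hvm, by omega, hvi.2⟩) w hvw)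
    obtain ⟨s, hs, rfl⟩ := h.flip.moves_across_slab hside (by omega) hright
      (mA.2 ⟨hwA.1, by omega, hwA.2.2⟩) hvw
    exact ⟨-s, by omega, by rw [Pi.single_neg]; abel⟩

/-- If two consecutive slices move backward and the loss is at most the size of a slice, then the
loss is the size of a slice and all motions are along the axis. -/
theorem movesAlong_of_backward_slices (h : IsBoxTranslation lo hi R) {i : ι}
    (hbox : ∀ j, lo j ≤ hi j) (hside : ∀ j, j ≠ i → lo j = hi j ∨ lo j + 2 ≤ hi j) {k : ℤ}
    (hlk : lo i ≤ k) (hkh : k + 1 ≤ hi i)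
    (hk : ∀ v ∈ slab lo hi i k (k + 1), R v (v + Pi.single i (-1)))
    (hloss : (lostVertices lo hi R).card ≤ (slab lo hi i k k).card) :
    (slab lo hi i k k).card ≤ (lostVertices lo hi R).card ∧ MovesAlong R i := by
  have hne : Function.update lo i k ∈ slab lo hi i k (k + 1) := by
    rw [mem_slab]
    exact ⟨fun j hj => by simp [hj, hbox j], by simp, by simp⟩
  have hlk' : lo i ≤ k - 1 := by
    have := (mem_Icc_pi.1 (h.mem_right (hk _ hne)) i).1
    simp at this
    omega
  have key := h.flip.movesAlong_of_forward_slices (k := k - 1) hbox hside hlk' (fun v hv => ?_)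
    (by rwa [h.card_lostVertices_flip, card_slice i (k - 1) k])
  · rw [h.card_lostVertices_flip, card_slice i (k - 1) k] at key
    exact ⟨key.1, key.2.of_flip⟩
  · rw [mem_slab_iff hlk' (by omega)] at hv
    have hm : v + Pi.single i 1 ∈ Finset.Icc lo hi :=
      add_single_mem_Icc hv.1 (by omega) (by omega)
    have := hk (v + Pi.single i 1)
      ((mem_slab_iff hlk hkh).2 ⟨hm, by simp; omega, by simp; omega⟩)
    rw [Pi.single_neg] at this
    simpa [flip] using this

/-- The slice in front of two exchanged slices is lost. -/
theorem lost_of_swap_front (h : IsBoxTranslation lo hi R) {i : ι} {s k : ℤ} (hs : s = 1 ∨ s = -1)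
    (h₁ : ∀ v ∈ slab lo hi i k k, R v (v + Pi.single i s))
    (h₂ : ∀ v ∈ slab lo hi i (k + s) (k + s), R v (v + Pi.single i (-s))) :
    slab lo hi i (k + s + s) (k + s + s) ∩ Finset.Icc lo hi ⊆ lostVertices lo hi R := by
  intro v hv
  rw [Finset.mem_inter, mem_slab] at hv
  obtain ⟨⟨hv₁, hv₂⟩, hv₃⟩ := hv
  rw [mem_lostVertices]
  refine ⟨hv₃, ?_⟩
  rintro ⟨w, hw⟩
  have e : (Pi.single i (-s) : ι → ℤ) = -Pi.single i s := Pi.single_neg ..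
  have m₁ : v - Pi.single i s ∈ slab lo hi i (k + s) (k + s) := by
    rw [mem_slab]
    exact ⟨fun j hj => by simpa [hj] using hv₁ j hj, by simp; omega, by simp; omega⟩
  have m₂ : v - Pi.single i s - Pi.single i s ∈ slab lo hi i k k := by
    rw [mem_slab]
    exact ⟨fun j hj => by simpa [hj] using hv₁ j hj, by simp; omega, by simp; omega⟩
  have r₁ := h₂ _ m₁
  have r₂ := h₁ _ m₂
  rw [e] at r₁
  rw [sub_add_cancel] at r₂
  have h₃ := h.eq_of_behind r₁ rfl (by simpa using hw)
  subst h₃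
  have h₄ := congrFun (h.injective hw r₂) i
  simp at h₄
  omega

/-- A slab of two slices on which a translation of small loss is defined everywhere either forces
all motions along the axis, or is exchanged. -/
theorem movesAlong_or_swap (h : IsBoxTranslation lo hi R) {i : ι}
    (hbox : ∀ j, lo j ≤ hi j) (hside : ∀ j, j ≠ i → lo j = hi j ∨ lo j + 2 ≤ hi j) {k : ℤ}
    (hlk : lo i ≤ k) (hkh : k + 1 ≤ hi i) (hk : ∀ v ∈ slab lo hi i k (k + 1), ∃ w, R v w)
    (hloss : (lostVertices lo hi R).card ≤ (slab lo hi i k k).card) :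
    ((slab lo hi i k k).card ≤ (lostVertices lo hi R).card ∧ MovesAlong R i) ∨
      (k + 2 ≤ hi i → slab lo hi i (k + 2) (k + 2) ⊆ lostVertices lo hi R) ∧
      (lo i ≤ k - 1 → slab lo hi i (k - 1) (k - 1) ⊆ lostVertices lo hi R) := by
  obtain ⟨s, hs, h₁⟩ := h.exists_slice_motion hbox hside (by omega) hk le_rfl (by omega)
  obtain ⟨t, ht, h₂⟩ := h.exists_slice_motion hbox hside (by omega) hk (by omega) le_rfl
  have hboth : s = t → ∀ v ∈ slab lo hi i k (k + 1), R v (v + Pi.single i s) := by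
    rintro rfl v hv
    have hv' := mem_slab.1 hv
    rcases eq_or_lt_of_le hv'.2.1 with h3 | h3
    · exact h₁ v (mem_slab.2 ⟨hv'.1, by omega, by omega⟩)
    · exact h₂ v (mem_slab.2 ⟨hv'.1, by omega, by omega⟩)
  rcases hs with rfl | rfl <;> rcases ht with rfl | rfl
  · exact Or.inl (h.movesAlong_of_forward_slices hbox hside hlk (hboth rfl) hloss)
  · right
    constructor
    · intro hk2 v hv
      refine h.lost_of_swap_front (Or.inl rfl) h₁ h₂ ?_
      rw [add_assoc, Finset.mem_inter]
      exact ⟨hv, ((mem_slab_iff (by omega) hk2).1 hv).1⟩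
    · intro hk2 v hv
      refine h.lost_of_swap_front (k := k + 1) (Or.inr rfl) h₂ (by simpa using h₁) ?_
      rw [Finset.mem_inter, show k + 1 + -1 + -1 = k - 1 by ring]
      exact ⟨hv, ((mem_slab_iff hk2 (by omega)).1 hv).1⟩
  -- Slices moving apart would put adjacent vertices at distance three.
  · exfalso
    have m₁ : Function.update lo i k ∈ slab lo hi i k k := by
      rw [mem_slab]
      exact ⟨fun j hj => by simp [hj, hbox j], by simp⟩
    have m₂ : Function.update lo i k + Pi.single i 1 ∈ slab lo hi i (k + 1) (k + 1) := by
      rw [mem_slab]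
      exact ⟨fun j hj => by simp [hj, hbox j], by simp⟩
    rcases h.parallel_or_follow (h₁ _ m₁) (h₂ _ m₂)
      (by simpa using isUnitVec_single i (Or.inl rfl)) with h3 | h3 | h3 <;>
    · have := congrFun h3 i
      simp at this
      try omega
  · exact Or.inl (h.movesAlong_of_backward_slices hbox hside hlk hkh (hboth rfl) hloss)

/-- A translation of small loss is defined everywhere on some slab of two slices. -/
theorem exists_slab_subset_domain {i : ι}
    (hw : lo i + 2 * (lostVertices lo hi R).card + 1 ≤ hi i) :
    ∃ k, lo i ≤ k ∧ k + 1 ≤ hi i ∧ ∀ v ∈ slab lo hi i k (k + 1), ∃ w, R v w := by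
  set n := (lostVertices lo hi R).card with hn
  -- Pigeonhole: `n` lost vertices cannot meet all `n + 1` disjoint pairs of slices `lo i + 2 * t`,
  -- `lo i + 2 * t + 1`.
  obtain ⟨t, ht, ht'⟩ : ∃ t ∈ Finset.range (n + 1),
      t ∉ (lostVertices lo hi R).image fun v => ((v i - lo i) / 2).toNat := by
    by_contra! hc
    have := (Finset.card_le_card (show Finset.range (n + 1) ⊆ _ from hc)).trans
      Finset.card_image_le
    rw [Finset.card_range] at this
    omega
  rw [Finset.mem_range] at ht
  refine ⟨lo i + 2 * t, by omega, by omega, fun v hv => ?_⟩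
  rw [mem_slab_iff (by omega) (by omega)] at hv
  by_contra hc
  exact ht' (Finset.mem_image.2 ⟨v, mem_lostVertices.2 ⟨hv.1, hc⟩, by omega⟩)

/-- If some other axis is not degenerate, and the axis `i` is long, a translation of loss at most
the size of a slice has exactly that loss, and all its motions are along the axis `i`. -/
theorem movesAlong_of_long (h : IsBoxTranslation lo hi R) {i : ι}
    (hbox : ∀ j, lo j ≤ hi j) (hside : ∀ j, j ≠ i → lo j = hi j ∨ lo j + 2 ≤ hi j)
    (hlong : lo i + 2 * (slab lo hi i (hi i) (hi i)).card + 1 ≤ hi i)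
    (hslice : 3 ≤ (slab lo hi i (hi i) (hi i)).card)
    (hloss : (lostVertices lo hi R).card ≤ (slab lo hi i (hi i) (hi i)).card) :
    (slab lo hi i (hi i) (hi i)).card ≤ (lostVertices lo hi R).card ∧ MovesAlong R i := by
  have hcs := fun k => card_slice (lo := lo) (hi := hi) i k (hi i)
  have hdisj : ∀ {k l}, k ≠ l → slab lo hi i k k ⊆ lostVertices lo hi R →
      slab lo hi i l l ⊆ lostVertices lo hi R → False := by
    intro k l hkl hk hl
    have hd : Disjoint (slab lo hi i k k) (slab lo hi i l l) :=
      Finset.disjoint_left.2 fun v hv hv' => by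
        have := mem_slab.1 hv
        have := mem_slab.1 hv'
        omega
    have := Finset.card_le_card (Finset.union_subset hk hl)
    rw [Finset.card_union_of_disjoint hd, hcs k, hcs l] at this
    omega
  have hdom : ∀ {k l}, slab lo hi i k k ⊆ lostVertices lo hi R → lo i ≤ l → l + 1 ≤ hi i →
      (k < l ∨ l + 1 < k) → ∀ v ∈ slab lo hi i l (l + 1), ∃ w, R v w := by
    intro k l hk hl hl' hkl v hv
    by_contra hc
    have hv' := (mem_slab_iff hl hl').1 hv
    -- A wholly lost slice uses up the allowed loss, so nothing else is lost.
    have hEq := Finset.eq_of_subset_of_card_le hk (by rw [hcs]; exact hloss)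
    have h1 : v ∈ slab lo hi i k k := hEq ▸ mem_lostVertices.2 ⟨hv'.1, hc⟩
    have := mem_slab.1 h1
    omega
  obtain ⟨k, hlk, hkh, hk⟩ := exists_slab_subset_domain (lo := lo) (hi := hi) (R := R) (i := i)
    (by omega)
  have key := h.movesAlong_or_swap hbox hside hlk hkh hk (by rwa [hcs])
  rw [hcs] at key
  rcases key with key | ⟨key₁, key₂⟩
  · exact key
  -- The exchange of `k` and `k + 1` costs the slices `k + 2` and `k - 1`, when present. The next
  -- pair tried lies just beyond one of these. Since `hslice` and `hlong` give at least eight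
  -- slices, a second exchange always leaves two distinct slices lost.
  by_cases hk4 : k + 4 ≤ hi i
  · have key' := h.movesAlong_or_swap hbox hside (k := k + 3) (by omega) (by omega)
      (hdom (key₁ (by omega)) (by omega) (by omega) (by omega)) (by rwa [hcs])
    rw [hcs] at key'
    rcases key' with key' | ⟨key₁', -⟩
    · exact key'
    exfalso
    by_cases hk5 : k + 5 ≤ hi i
    · exact hdisj (by omega) (key₁ (by omega)) (key₁' (by omega))
    · exact hdisj (by omega) (key₁ (by omega)) (key₂ (by omega))
  · have key' := h.movesAlong_or_swap hbox hside (k := k - 3) (by omega) (by omega)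
      (hdom (key₂ (by omega)) (by omega) (by omega) (by omega)) (by rwa [hcs])
    rw [hcs] at key'
    rcases key' with key' | ⟨-, key₂'⟩
    · exact key'
    exfalso
    exact hdisj (by omega) (key₂ (by omega)) (key₂' (by omega))

/-- A translation of a path of length at least three loses a vertex. -/
theorem movesAlong_of_degenerate (h : IsBoxTranslation lo hi R) {i : ι}
    (hside : ∀ j, j ≠ i → lo j = hi j) (hlong : lo i + 2 ≤ hi i) :
    (slab lo hi i (hi i) (hi i)).card ≤ (lostVertices lo hi R).card ∧ MovesAlong R i := by
  have hmoves : MovesAlong R i := by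
    intro v w hR
    obtain ⟨j, s, hs, hws⟩ := h.unit hR
    have hw : w = v + Pi.single j s := by rw [← hws]; abel
    subst hw
    rcases eq_or_ne j i with rfl | hj
    · exact ⟨s, hs, rfl⟩
    exfalso
    have h1 := mem_Icc_pi.1 (h.mem_left hR) j
    have h2 := mem_Icc_pi.1 (h.mem_right hR) j
    have h3 := hside j hj
    simp only [Pi.add_apply, Pi.single_eq_same] at h2
    omega
  refine ⟨?_, hmoves⟩
  have hone : (slab lo hi i (hi i) (hi i)).card = 1 := by
    rw [card_slab, Finset.prod_eq_one]
    · simp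
    · intro j hj
      rw [hside j (Finset.ne_of_mem_erase hj)]
      simp
  rw [hone, Nat.one_le_iff_ne_zero, Finset.card_ne_zero]
  by_contra hc
  have hdom : ∀ v ∈ Finset.Icc lo hi, ∃ w, R v w := by
    intro v hv
    by_contra hv'
    exact hc ⟨v, mem_lostVertices.2 ⟨hv, hv'⟩⟩
  have hlo : lo ∈ Finset.Icc lo hi := by
    rw [mem_Icc_pi]
    intro j
    rcases eq_or_ne j i with rfl | hj
    · omega
    · simp [hside j hj]
  obtain ⟨w, hw⟩ := hdom lo hlo
  obtain ⟨s, hs, rfl⟩ := hmoves _ _ hw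
  exact h.not_move hdom rfl rfl hlong (fun _ _ => Or.inl ⟨rfl, rfl⟩) hs hlo hw

end IsBoxTranslation
end Slabs

/-! ### Blocks with the coordinates before `j` frozen -/

section Blocks

variable {D : ℕ} {lo hi : Fin D → ℤ} {R : (Fin D → ℤ) → (Fin D → ℤ) → Prop}

/-- The vector that agrees with `c` on the axes before `j`, and with `b` from `j` on. -/
def freezeBelow (j : Fin D) (c b : Fin D → ℤ) : Fin D → ℤ := fun l => if l < j then c l else b l

theorem mem_block {j : Fin D} {c v : Fin D → ℤ} (hc : c ∈ Finset.Icc lo hi) :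
    v ∈ Finset.Icc (freezeBelow j c lo) (freezeBelow j c hi) ↔
      v ∈ Finset.Icc lo hi ∧ ∀ l, l < j → v l = c l := by
  rw [mem_Icc_pi] at hc
  simp only [mem_Icc_pi, freezeBelow]
  constructor
  · intro h
    refine ⟨fun l => ?_, fun l hl => ?_⟩
    · have := h l
      have := hc l
      split_ifs at * <;> omega
    · have := h l
      simp only [if_pos hl] at this
      omega
  · rintro ⟨h, h'⟩ l
    split_ifs with hl
    · simp [h' l hl]
    · exact h l

/-- The restriction of `R` to the block through `c`. -/
def blockRel (lo hi : Fin D → ℤ) (R : (Fin D → ℤ) → (Fin D → ℤ) → Prop) (j : Fin D)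
    (c : Fin D → ℤ) (v w : Fin D → ℤ) : Prop :=
  R v w ∧ v ∈ Finset.Icc (freezeBelow j c lo) (freezeBelow j c hi)

/-- Motions along axes from `j` on leave the frozen coordinates unchanged, so they stay in the
block. -/
theorem IsBoxTranslation.block (h : IsBoxTranslation lo hi R) {j : Fin D}
    (hmin : ∀ l s v, (s = 1 ∨ s = -1) → R v (v + Pi.single l s) → j ≤ l)
    {c : Fin D → ℤ} (hc : c ∈ Finset.Icc lo hi) :
    IsBoxTranslation (freezeBelow j c lo) (freezeBelow j c hi) (blockRel lo hi R j c) where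
  mem_left h' := h'.2
  mem_right {v w} h' := by
    obtain ⟨hR, hv⟩ := h'
    obtain ⟨l, s, hs, hws⟩ := h.unit hR
    have hw : w = v + Pi.single l s := by rw [← hws]; abel
    subst hw
    have hjl := hmin l s v hs hR
    refine (mem_block hc).2 ⟨h.mem_right hR, fun m hm => ?_⟩
    have hml : m ≠ l := (hm.trans_le hjl).ne
    simpa [hml] using ((mem_block hc).1 hv).2 m hm
  functional h₁ h₂ := h.functional h₁.1 h₂.1
  injective h₁ h₂ := h.injective h₁.1 h₂.1
  unit h' := h.unit h'.1
  adj_iff h₁ h₂ := h.adj_iff h₁.1 h₂.1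

/-- The vector `freezeBelow j v 0` labels the block of `v`, so that losses can be summed over the
fibres of this label. -/
theorem lostVertices_block {j : Fin D} {c : Fin D → ℤ} (hc : c ∈ Finset.Icc lo hi) :
    lostVertices (freezeBelow j c lo) (freezeBelow j c hi) (blockRel lo hi R j c) =
      {v ∈ lostVertices lo hi R | freezeBelow j v 0 = freezeBelow j c 0} := by
  ext v
  have e : freezeBelow j v 0 = freezeBelow j c 0 ↔ ∀ l, l < j → v l = c l := by
    rw [funext_iff]
    refine forall_congr' fun l => ?_
    by_cases hl : l < j <;> simp [freezeBelow, hl]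
  rw [Finset.mem_filter, mem_lostVertices, mem_lostVertices, mem_block hc, e]
  constructor
  · rintro ⟨h1, h2⟩
    exact ⟨⟨h1.1, fun ⟨w, hw⟩ => h2 ⟨w, hw, (mem_block hc).2 h1⟩⟩, h1.2⟩
  · rintro ⟨h1, h2⟩
    exact ⟨⟨h1.1, h2⟩, fun ⟨w, hw⟩ => h1.2 ⟨w, hw.1⟩⟩

theorem slab_block {j : Fin D} {c : Fin D → ℤ} (hc : c ∈ Finset.Icc lo hi) {k : ℤ}
    (hk : lo j ≤ k) (hk' : k ≤ hi j) :
    slab (freezeBelow j c lo) (freezeBelow j c hi) j k k =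
      {v ∈ slab lo hi j k k | freezeBelow j v 0 = freezeBelow j c 0} := by
  ext v
  have e : freezeBelow j v 0 = freezeBelow j c 0 ↔ ∀ l, l < j → v l = c l := by
    rw [funext_iff]
    refine forall_congr' fun l => ?_
    by_cases hl : l < j <;> simp [freezeBelow, hl]
  rw [Finset.mem_filter, mem_slab_iff hk hk',
    mem_slab_iff (by simpa [freezeBelow] using hk) (by simpa [freezeBelow] using hk'),
    mem_block hc, e]
  tauto

/-- Frozen axes contribute a factor one, which leaves the product occurring in the growth
assumption. -/
theorem card_slab_block {j : Fin D} {c : Fin D → ℤ} (k : ℤ) :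
    (slab (freezeBelow j c lo) (freezeBelow j c hi) j k k).card =
      ∏ l ∈ Finset.Ioi j, (hi l + 1 - lo l).toNat := by
  rw [card_slab]
  simp only [add_sub_cancel_left, Int.toNat_one, one_mul]
  rw [← Finset.prod_subset (s₁ := Finset.Ioi j)]
  · refine Finset.prod_congr rfl fun l hl => ?_
    simp [freezeBelow, (Finset.mem_Ioi.1 hl).not_gt]
  · intro l hl
    simpa using (Finset.mem_Ioi.1 hl).ne'
  · intro l hl hl'
    rw [Finset.mem_Ioi] at hl'
    have : l < j := lt_of_le_of_ne (not_lt.1 hl') (Finset.ne_of_mem_erase hl)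
    simp [freezeBelow, this]

end Blocks

/-! ### Large grids and the final induction -/

section Grid

variable {D : ℕ} {d : Fin D → ℕ}

theorem IsLargeGrid.three_le (hd : IsLargeGrid d) (i : Fin D) : 3 ≤ d i := by
  have hpos : ∀ j, 0 < d j := by
    intro j
    rcases (show (j : ℕ) + 1 = D ∨ (j : ℕ) + 1 < D by omega) with h | h
    · exact lt_of_lt_of_le (by norm_num) (hd.1 j h)
    · have := hd.2 j h
      omega
  rcases (show (i : ℕ) + 1 = D ∨ (i : ℕ) + 1 < D by omega) with h | h
  · exact hd.1 i h
  · have h1 := hd.2 i h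
    have h2 : 0 < ∏ j ∈ Finset.Ioi i, d j := Finset.prod_pos fun j _ => hpos j
    omega

variable {R : (Fin D → ℤ) → (Fin D → ℤ) → Prop}

/-- On a large grid, a translation with no motion along the axes before `j` loses at least as many
vertices as a Euclidean translation along the axis `j`, with equality only if all its motions are
along that axis. -/
theorem IsBoxTranslation.card_slab_le_card_lostVertices (hd : IsLargeGrid d)
    (h : IsBoxTranslation 1 (fun l => (d l : ℤ)) R) {j : Fin D}
    (hmin : ∀ l s v, (s = 1 ∨ s = -1) → R v (v + Pi.single l s) → j ≤ l) :
    (slab 1 (fun l => (d l : ℤ)) j (d j) (d j)).card ≤ (lostVertices 1 (fun l => (d l : ℤ)) R).card ∧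
      ((lostVertices 1 (fun l => (d l : ℤ)) R).card ≤
        (slab 1 (fun l => (d l : ℤ)) j (d j) (d j)).card → MovesAlong R j) := by
  classical
  set hi : Fin D → ℤ := fun l => (d l : ℤ) with hhi
  have h3 : ∀ l, (3 : ℤ) ≤ hi l := fun l => Nat.ofNat_le_cast.2 (hd.three_le l)
  set S := slab 1 hi j (hi j) (hi j) with hS
  set L := lostVertices 1 hi R with hL
  set T := (Finset.Icc 1 hi).image fun v => freezeBelow j v 0 with hT
  have hblock : ∀ c ∈ Finset.Icc 1 hi,
      ({v ∈ L | freezeBelow j v 0 = freezeBelow j c 0}).card ≤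
        ({v ∈ S | freezeBelow j v 0 = freezeBelow j c 0}).card →
      ({v ∈ S | freezeBelow j v 0 = freezeBelow j c 0}).card ≤
        ({v ∈ L | freezeBelow j v 0 = freezeBelow j c 0}).card ∧
      MovesAlong (blockRel 1 hi R j c) j := by
    intro c hc hle
    have hone : (1 : Fin D → ℤ) j ≤ hi j := by have := h3 j; simp; omega
    rw [hL, hS, ← lostVertices_block hc, ← slab_block hc hone le_rfl] at *
    have hb := h.block hmin hc
    have hfj : freezeBelow j c hi j = hi j := by simp [freezeBelow]
    have hcard := card_slab_block (lo := 1) (hi := hi) (j := j) (c := c) (hi j)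
    have hcard' : ∏ l ∈ Finset.Ioi j, (hi l + 1 - (1 : Fin D → ℤ) l).toNat =
        ∏ l ∈ Finset.Ioi j, d l := Finset.prod_congr rfl fun l _ => by simp [hhi]
    rw [hcard'] at hcard
    have hsideR : ∀ l, j < l → freezeBelow j c 1 l + 2 ≤ freezeBelow j c hi l := by
      intro l hl
      have := h3 l
      simp only [freezeBelow, hl.not_gt, if_false, Pi.one_apply]
      omega
    have hsideL : ∀ l, l < j → freezeBelow j c 1 l = freezeBelow j c hi l := by
      intro l hl
      simp [freezeBelow, hl]
    -- For the last axis the block is a path; otherwise the growth assumption is exactly the length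
    -- required by `movesAlong_of_long`.
    rcases (show (j : ℕ) + 1 = D ∨ (j : ℕ) + 1 < D by omega) with hj | hj
    · have := hb.movesAlong_of_degenerate (i := j) (fun l hl => hsideL l (by omega))
        (by have := h3 j; simp [freezeBelow]; omega)
      rwa [hfj] at this
    · have hlast : d ⟨j + 1, hj⟩ ≤ ∏ l ∈ Finset.Ioi j, d l :=
        Nat.le_of_dvd (Finset.prod_pos fun l _ => by have := hd.three_le l; omega)
          (Finset.dvd_prod_of_mem d (Finset.mem_Ioi.2 (by simp [Fin.lt_def])))
      have h4 := hd.three_le ⟨j + 1, hj⟩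
      have h5 := hd.2 j hj
      have := hb.movesAlong_of_long (i := j) (fun l => ?_) (fun l hl => ?_) ?_ ?_ ?_
      · rwa [hfj] at this
      · have := h3 l
        rcases lt_trichotomy l j with h6 | rfl | h6
        · exact (hsideL l h6).le
        · simp [freezeBelow]; omega
        · have := hsideR l h6; omega
      · rcases lt_or_gt_of_ne hl with h6 | h6
        · exact Or.inl (hsideL l h6)
        · exact Or.inr (hsideR l h6)
      · rw [hfj, hcard]
        simp only [freezeBelow, lt_irrefl, if_false, Pi.one_apply, hhi]
        zify at h5
        push_cast
        omega
      · rw [hfj, hcard]; omega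
      · rwa [hfj]
  have hle : ∀ b ∈ T, ({v ∈ S | freezeBelow j v 0 = b}).card ≤
      ({v ∈ L | freezeBelow j v 0 = b}).card := by
    intro b hb
    obtain ⟨c, hc, rfl⟩ := Finset.mem_image.1 hb
    rcases le_total ({v ∈ S | freezeBelow j v 0 = freezeBelow j c 0}).card
      ({v ∈ L | freezeBelow j v 0 = freezeBelow j c 0}).card with h6 | h6
    · exact h6
    · exact (hblock c hc h6).1
  have hSsum : S.card = ∑ b ∈ T, ({v ∈ S | freezeBelow j v 0 = b}).card :=
    Finset.card_eq_sum_card_fiberwise fun v hv => Finset.mem_image_of_mem _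
      ((mem_slab_iff (by have := h3 j; simp; omega) le_rfl).1 hv).1
  have hLsum : L.card = ∑ b ∈ T, ({v ∈ L | freezeBelow j v 0 = b}).card :=
    Finset.card_eq_sum_card_fiberwise fun v hv => Finset.mem_image_of_mem _
      (mem_lostVertices.1 hv).1
  refine ⟨by rw [hSsum, hLsum]; exact Finset.sum_le_sum hle, fun hLS v w hR => ?_⟩
  have heq : ∑ b ∈ T, ({v ∈ S | freezeBelow j v 0 = b}).card =
      ∑ b ∈ T, ({v ∈ L | freezeBelow j v 0 = b}).card :=
    le_antisymm (Finset.sum_le_sum hle) (by rw [← hSsum, ← hLsum]; exact hLS)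
  -- Equality of the totals forces equality in every block, hence motion along `j` in each.
  rw [Finset.sum_eq_sum_iff_of_le hle] at heq
  have hv := h.mem_left hR
  exact (hblock v hv (heq _ (Finset.mem_image_of_mem _ hv)).ge).2 v w
    ⟨hR, (mem_block hv).2 ⟨hv, fun _ _ => rfl⟩⟩

theorem gridGraph_adj_iff {v w : GridVertex d} :
    (gridGraph d).Adj v w ↔ IsUnitVec (w.1 - v.1) := by
  constructor
  · rintro ⟨i, h1, h2⟩
    refine ⟨i, w.1 i - v.1 i, ?_, ?_⟩
    · rcases (abs_eq (by norm_num)).1 h1 with h | h <;> omega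
    · ext l
      rcases eq_or_ne l i with rfl | hl
      · simp
      · simp [hl, h2 l hl]
  · rintro ⟨i, s, hs, h⟩
    refine ⟨i, ?_, fun l hl => ?_⟩
    · have := congrFun h i
      simp only [Pi.sub_apply, Pi.single_eq_same] at this
      rw [abs_eq (by norm_num)]
      omega
    · have := congrFun h l
      simp [hl] at this
      omega

namespace GraphTransformation

/-- The graph of a transformation of a grid, as a relation on the integer lattice. -/
def toRel (ψ : GraphTransformation (GridVertex d)) (v w : Fin D → ℤ) : Prop :=
  ∃ hv hw, ψ.toFun (some ⟨v, hv⟩) = some ⟨w, hw⟩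

theorem IsTranslation.isBoxTranslation {ψ : GraphTransformation (GridVertex d)}
    (h : ψ.IsTranslation (gridGraph d)) :
    IsBoxTranslation 1 (fun l => (d l : ℤ)) ψ.toRel where
  mem_left := by
    rintro v w ⟨hv, -⟩
    exact mem_Icc_pi.2 hv
  mem_right := by
    rintro v w ⟨-, hw, -⟩
    exact mem_Icc_pi.2 hw
  functional := by
    rintro v w w' ⟨hv, hw, h₁⟩ ⟨hv', hw', h₂⟩
    simpa using h₁.symm.trans h₂
  injective := by
    rintro v v' w ⟨hv, hw, h₁⟩ ⟨hv', hw', h₂⟩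
    have := ψ.inj _ _ (by rw [h₁]; simp) (by rw [h₂]; simp) (h₁.trans h₂.symm)
    simpa using this
  unit := by
    rintro v w ⟨hv, hw, h₁⟩
    exact gridGraph_adj_iff.1 (h.1 _ _ h₁)
  adj_iff := by
    rintro v v' w w' ⟨hv, hw, h₁⟩ ⟨hv', hw', h₂⟩
    have := h.2 _ _ _ _ h₁ h₂
    rwa [gridGraph_adj_iff, gridGraph_adj_iff] at this

theorem loss_eq_card_lostVertices (ψ : GraphTransformation (GridVertex d)) :
    ψ.loss = (lostVertices 1 (fun l => (d l : ℤ)) ψ.toRel).card := by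
  rw [loss, ← Set.ncard_image_of_injective _ Subtype.val_injective, ← Set.ncard_coe_finset]
  congr 1
  ext v
  simp only [Set.mem_image, Set.mem_ofPred_eq, Finset.mem_coe, mem_lostVertices, mem_Icc_pi]
  constructor
  · rintro ⟨x, hx, rfl⟩
    refine ⟨x.2, ?_⟩
    rintro ⟨w, hv, hw, h⟩
    rw [hx] at h
    simp at h
  · rintro ⟨hv, h⟩
    refine ⟨⟨v, hv⟩, ?_, rfl⟩
    by_contra hc
    obtain ⟨w, hw⟩ := Option.ne_none_iff_exists'.1 hc
    exact h ⟨w.1, hv, w.2, hw⟩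

end GraphTransformation

open GraphTransformation

theorem toFun_euclideanTranslation {δ : Fin D → ℤ} {v w : GridVertex d} :
    (euclideanTranslation d δ).toFun (some v) = some w ↔ w.1 = v.1 + δ := by
  simp only [euclideanTranslation, Option.bind_some]
  split_ifs with h
  · rw [Option.some_inj, Subtype.ext_iff]
    exact eq_comm
  · simp only [false_iff]
    intro hw
    exact h (hw ▸ w.2)

theorem isTranslation_euclideanTranslation {δ : Fin D → ℤ} (hδ : IsUnitVec δ) :
    (euclideanTranslation d δ).IsTranslation (gridGraph d) := by
  constructor
  · intro v w h
    rw [toFun_euclideanTranslation] at h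
    rw [gridGraph_adj_iff, h]
    simpa using hδ
  · intro v₁ v₂ w₁ w₂ h₁ h₂
    rw [toFun_euclideanTranslation] at h₁ h₂
    rw [gridGraph_adj_iff, gridGraph_adj_iff, h₁, h₂, add_sub_add_right_eq_sub]

/-- The last slice is lost for `s = 1` and the first for `s = -1`; they have the same size. -/
theorem loss_euclideanTranslation_single (hd : ∀ l, 1 ≤ d l) (i : Fin D) {s : ℤ}
    (hs : s = 1 ∨ s = -1) :
    (euclideanTranslation d (Pi.single i s)).loss =
      (slab 1 (fun l => (d l : ℤ)) i (d i) (d i)).card := by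
  have hdi : (1 : ℤ) ≤ d i := by exact_mod_cast hd i
  obtain ⟨k, hk₁, hk₂, hk⟩ : ∃ k : ℤ, 1 ≤ k ∧ k ≤ d i ∧
      ∀ x : ℤ, 1 ≤ x → x ≤ d i → (x = k ↔ ¬ (1 ≤ x + s ∧ x + s ≤ d i)) := by
    rcases hs with rfl | rfl
    · exact ⟨d i, hdi, le_rfl, fun x _ _ => by omega⟩
    · exact ⟨1, le_rfl, hdi, fun x _ _ => by omega⟩
  rw [loss_eq_card_lostVertices, card_slice i (d i : ℤ) k]
  congr 1
  ext v
  rw [mem_lostVertices, mem_slab_iff (lo := 1) (hi := fun l => (d l : ℤ)) hk₁ hk₂]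
  refine and_congr_right fun hv => ?_
  have hvi := mem_Icc_pi.1 hv i
  have : (k ≤ v i ∧ v i ≤ k) ↔ v i = k := by omega
  rw [this, hk _ (by simpa using hvi.1) hvi.2, not_iff_not]
  constructor
  · rintro ⟨w, hv', hw, h⟩
    rw [toFun_euclideanTranslation] at h
    simp only at h
    have := hw i
    rw [h] at this
    simpa using this
  · rintro ⟨h₁, h₂⟩
    refine ⟨v + Pi.single i s, mem_Icc_pi.1 hv, mem_Icc_pi.1 (add_single_mem_Icc hv h₁ h₂), ?_⟩
    rw [toFun_euclideanTranslation]

/-- Both signs go through the induction together, because the dominating translation along the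
smaller axis may point either way. -/
theorem isPseudoMinimal_euclideanTranslation_single (hd : IsLargeGrid d) (i : Fin D) :
    ∀ s : ℤ, (s = 1 ∨ s = -1) →
      (euclideanTranslation d (Pi.single i s)).IsPseudoMinimal (gridGraph d) := by
  have hd1 : ∀ l, 1 ≤ d l := fun l => le_trans (by norm_num) (hd.three_le l)
  induction i using WellFoundedLT.induction with
  | ind i ih =>
    intro s hs
    rw [isPseudoMinimal_iff]
    refine ⟨isTranslation_euclideanTranslation (isUnitVec_single i hs), Or.inr ?_⟩
    rintro ψ hψ ⟨hloss, v, w, hvw, hvw'⟩ hpm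
    rw [toFun_euclideanTranslation] at hvw
    have hR : ψ.toRel v.1 (v.1 + Pi.single i s) := ⟨v.2, hvw ▸ w.2, by
      rw [Subtype.coe_eta, hvw']
      exact congrArg some (Subtype.ext hvw)⟩
    -- The least axis used by `ψ`; the edge from `u` is the one that `ψ` will share with the
    -- Euclidean translation along `j`.
    obtain ⟨j, ⟨t, u, ht, hu⟩, hj⟩ := (wellFounded_lt (α := Fin D)).has_min
      {j | ∃ t u, (t = 1 ∨ t = -1) ∧ ψ.toRel u (u + Pi.single j t)} ⟨i, s, v.1, hs, hR⟩
    have hji : j ≤ i := not_lt.1 (hj i ⟨s, v.1, hs, hR⟩)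
    obtain ⟨h₁, h₂⟩ := hψ.isBoxTranslation.card_slab_le_card_lostVertices hd (j := j)
      fun l s' v' hs' hR' => not_lt.1 (hj l ⟨s', v', hs', hR'⟩)
    rw [← loss_eq_card_lostVertices] at h₁ h₂
    rw [← loss_euclideanTranslation_single hd1 j ht] at h₁ h₂
    have hne : j ≠ i := by
      rintro rfl
      rw [loss_euclideanTranslation_single hd1 j hs,
        ← loss_euclideanTranslation_single hd1 j ht] at hloss
      omega
    -- Equal loss would make all motions of `ψ` parallel to `j`, against its shared edge along `i`.
    have hlt : (euclideanTranslation d (Pi.single j t)).loss < ψ.loss := by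
      by_contra hc
      obtain ⟨s', -, h₃⟩ := h₂ (not_lt.1 hc) _ _ hR
      have h₄ := congrFun (add_left_cancel h₃) i
      simp [Ne.symm hne] at h₄
      omega
    have hprec : Prec ψ (euclideanTranslation d (Pi.single j t)) := by
      obtain ⟨hu₁, hu₂, hu₃⟩ := hu
      exact ⟨hlt, _, _, hu₃, toFun_euclideanTranslation.2 rfl⟩
    have htr := isTranslation_euclideanTranslation (d := d) (isUnitVec_single j ht)
    rw [isPseudoMinimal_iff] at hpm
    rcases hpm.2 with h | h
    · exact h.2 ⟨_, htr, hprec⟩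
    · exact h _ htr hprec (ih j (lt_of_le_of_ne hji hne) t ht)

end Grid

theorem mainTheorem4 {D : ℕ} (d : Fin D → ℕ) (hd : IsLargeGrid d) (i : Fin D) :
    (euclideanTranslation d (diracVector i)).IsPseudoMinimal (gridGraph d) := by
  have h : diracVector i = Pi.single i 1 := by
    ext j
    simp [diracVector, Pi.single_apply]
  rw [h]
  exact isPseudoMinimal_euclideanTranslation_single hd i 1 (Or.inl rfl)
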